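/- \textbf{Setting.} All graded objects are $\mathbb{Z}$-graded families and only homogeneous elements are used. Let $\mathcal{M}=(M,\mathcal{C}^\infty_{\mathcal{M}})$ be a $\mathbb{Z}$-graded manifold: $M$ is second countable Hausdorff, $\mathcal{C}^\infty_{\mathcal{M}}$ is a sheaf of graded commutative associative unital real algebras with local stalks, locally isomorphic to the sheaf of formal power series in finitely many graded variables of non-zero integer degrees (with $\xi_\mu\xi_\nu=(-1)^{|\xi_\mu||\xi_\nu|}\xi_\nu\xi_\mu$), with smooth coefficients on open subsets of $\mathbb{R}^{n_0}$. A graded vector bundle $\mathcal{E}$ over $\mathcal{M}$ is a sheaf $\Gamma_{\mathcal{E}}$ of graded $\mathcal{C}^\infty_{\mathcal{M}}$-modules, locally freely and finitely generated of constant graded rank; a subbundle is a subsheaf of graded submodules, of constant graded rank, which locally is generated by the first members of a local frame of $\mathcal{E}$. A vector bundle map $F:\mathcal{E}\to\mathcal{E}'$ of degree $|F|$ is a graded linear map $\Gamma_{\mathcal{E}}(M)\to\Gamma_{\mathcal{E}'}(M)$ of degree $|F|$ with $F(f\psi)=(-1)^{|f||F|}fF(\psi)$; it extends uniquely to a sheaf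 morphism, whose components are denoted $F|_U$. Sections of $T\mathcal{M}$ are the graded derivations of $\mathcal{C}^\infty_{\mathcal{M}}(M)$, and sections of $\mathcal{E}^*$ are the graded $\mathcal{C}^\infty_{\mathcal{M}}(M)$-linear maps $\Gamma_{\mathcal{E}}(M)\to\mathcal{C}^\infty_{\mathcal{M}}(M)$. A \emph{graded Courant algebroid of degree $\ell\in\mathbb{Z}$} is a tuple $(\mathcal{E},\rho,g_{\mathcal{E}},[\cdot,\cdot]_{\mathcal{E}})$ of a graded vector bundle $\mathcal{E}$, a vector bundle map $\rho:\mathcal{E}\to T\mathcal{M}$ of degree $\ell$, a vector bundle isomorphism $g_{\mathcal{E}}:\mathcal{E}\to\mathcal{E}^*$ of degree $\ell$ such that $\langle\psi,\psi'\rangle_{\mathcal{E}}:=(-1)^{(|\psi|+\ell)\ell}[g_{\mathcal{E}}(\psi)](\psi')$ satisfies $\langle\psi,\psi'\rangle_{\mathcal{E}}=(-1)^{(|\psi|+\ell)(|\psi'|+\ell)}\langle\psi',\psi\rangle_{\mathcal{E}}$, and an $\mathbb{R}$-bilinear bracket of degree $\ell$ on $\Gamma_{\mathcal{E}}(M)$,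 such that, with $\hat\rho(\psi):=(-1)^{(|\psi|+\ell)\ell}\rho(\psi)$ and $\mathrm{D}:=g_{\mathcal{E}}^{-1}\circ\rho^T\circ\mathrm{d}$, where $(\mathrm{d}f)(X)=(-1)^{(|X|-1)|f|}X(f)$ and $[\rho^T(\alpha)](\psi)=(-1)^{|\alpha|\ell}\alpha(\rho(\psi))$, $$\hat\rho(\psi)\langle\psi',\psi''\rangle_{\mathcal{E}}=\langle[\psi,\psi']_{\mathcal{E}},\psi''\rangle_{\mathcal{E}}+(-1)^{(|\psi|+\ell)(|\psi'|+\ell)}\langle\psi',[\psi,\psi'']_{\mathcal{E}}\rangle_{\mathcal{E}},$$ $$[\psi,\psi']_{\mathcal{E}}+(-1)^{(|\psi|+\ell)(|\psi'|+\ell)}[\psi',\psi]_{\mathcal{E}}=(-1)^{|\psi|+|\psi'|}\mathrm{D}\langle\psi,\psi'\rangle_{\mathcal{E}},$$ $$[\psi,[\psi',\psi'']_{\mathcal{E}}]_{\mathcal{E}}=[[\psi,\psi']_{\mathcal{E}},\psi'']_{\mathcal{E}}+(-1)^{(|\psi|+\ell)(|\psi'|+\ell)}[\psi',[\psi,\psi'']_{\mathcal{E}}]_{\mathcal{E}}.$$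 Let $\mathcal{E}_{\mathbb{C}}$ be the complexification of $\mathcal{E}$, with sections $\psi+i\phi$ ($|\psi|=|\phi|$), and extend $\langle\cdot,\cdot\rangle_{\mathcal{E}}$ and $[\cdot,\cdot]_{\mathcal{E}}$ complex bilinearly. For a complex subbundle $\mathcal{L}\subseteq\mathcal{E}_{\mathbb{C}}$ let $\overline{\mathcal{L}}$ be its image under $\psi+i\phi\mapsto\psi-i\phi$. A \emph{generalized complex structure} is a complex subbundle $\mathcal{L}\subseteq\mathcal{E}_{\mathbb{C}}$ which is isotropic for $\langle\cdot,\cdot\rangle_{\mathcal{E}_{\mathbb{C}}}$, such that $\Gamma_{\mathcal{L}}(M)$ is closed under $[\cdot,\cdot]_{\mathcal{E}_{\mathbb{C}}}$, and such that $\mathcal{E}_{\mathbb{C}}=\mathcal{L}\oplus\overline{\mathcal{L}}$. \textbf{Proposition.} Let $(\mathcal{E},\rho,g_{\mathcal{E}},[\cdot,\cdot]_{\mathcal{E}})$ be a graded Courant algebroid of degree $\ell$ over $\mathcal{M}$ and let $\mathcal{L}\subseteq\mathcal{E}_{\mathbb{C}}$ be a generalized complex structure. Then there is a unique vector bundle map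 $\mathcal{J}:\mathcal{E}\to\mathcal{E}$ of degree zero with the following properties: (i) $\mathcal{J}^2=-1_{\mathcal{E}}$ and $\langle\mathcal{J}\psi,\mathcal{J}\psi'\rangle_{\mathcal{E}}=\langle\psi,\psi'\rangle_{\mathcal{E}}$ for all $\psi,\psi'\in\Gamma_{\mathcal{E}}(M)$; (ii) $N_{\mathcal{J}}(\psi,\psi'):=[\psi,\psi']_{\mathcal{E}}-[\mathcal{J}\psi,\mathcal{J}\psi']_{\mathcal{E}}+\mathcal{J}\big([\psi,\mathcal{J}\psi']_{\mathcal{E}}+[\mathcal{J}\psi,\psi']_{\mathcal{E}}\big)=0$ for all $\psi,\psi'\in\Gamma_{\mathcal{E}}(M)$; (iii) for every open $U\subseteq M$, $\Gamma_{\mathcal{L}}(U)$ is the $+i$ eigenspace and $\Gamma_{\overline{\mathcal{L}}}(U)$ the $-i$ eigenspace of $\mathcal{J}_{\mathbb{C}}|_U$. -/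

import Mathlib

open TopologicalSpace
open scoped Manifold ContDiff

universe u v w

noncomputable section

/-!
## Graded algebra

A graded object is a family indexed by `ℤ`; only homogeneous elements are considered.  Operations
that add degrees take a proof of the relation between the degrees, so that no casts are needed.
-/

/-- A graded linear map `V → W` of degree `d`: a family of linear maps `V i → W k`, one for each pair
of degrees with `i + d = k`. -/
@[ext]
structure GradedMap (𝕜 : Type*) [Field 𝕜] (V : ℤ → Type v) (W : ℤ → Type w)
    [∀ i, AddCommGroup (V i)] [∀ i, Module 𝕜 (V i)] [∀ i, AddCommGroup (W i)]
    [∀ i, Module 𝕜 (W i)] (d : ℤ) where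
  app : ∀ {i k : ℤ}, i + d = k → (V i →ₗ[𝕜] W k)

namespace GradedMap

variable {𝕜 : Type*} [Field 𝕜] {V : ℤ → Type v} {W : ℤ → Type w}
  [∀ i, AddCommGroup (V i)] [∀ i, Module 𝕜 (V i)] [∀ i, AddCommGroup (W i)]
  [∀ i, Module 𝕜 (W i)] {d : ℤ}

theorem ext' {F G : GradedMap 𝕜 V W d}
    (H : ∀ {i k : ℤ} (h : i + d = k) (x : V i), F.app h x = G.app h x) : F = G := by
  ext i k h x
  exact H h x

instance : Zero (GradedMap 𝕜 V W d) := ⟨⟨fun _ => 0⟩⟩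
instance : Add (GradedMap 𝕜 V W d) := ⟨fun F G => ⟨fun h => F.app h + G.app h⟩⟩
instance : Neg (GradedMap 𝕜 V W d) := ⟨fun F => ⟨fun h => -F.app h⟩⟩
instance : SMul 𝕜 (GradedMap 𝕜 V W d) := ⟨fun c F => ⟨fun h => c • F.app h⟩⟩

@[simp] theorem zero_app {i k : ℤ} (h : i + d = k) :
    (0 : GradedMap 𝕜 V W d).app h = 0 := rfl
@[simp] theorem add_app (F G : GradedMap 𝕜 V W d) {i k : ℤ} (h : i + d = k) :
    (F + G).app h = F.app h + G.app h := rfl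
@[simp] theorem neg_app (F : GradedMap 𝕜 V W d) {i k : ℤ} (h : i + d = k) :
    (-F).app h = -F.app h := rfl
@[simp] theorem smul_app (c : 𝕜) (F : GradedMap 𝕜 V W d) {i k : ℤ} (h : i + d = k) :
    (c • F).app h = c • F.app h := rfl

instance : AddCommGroup (GradedMap 𝕜 V W d) where
  add_assoc F G H := ext' fun h x => by simp [add_assoc]
  zero_add F := ext' fun h x => by simp
  add_zero F := ext' fun h x => by simp
  neg_add_cancel F := ext' fun h x => by simp
  add_comm F G := ext' fun h x => by simp [add_comm]
  nsmul := nsmulRec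
  zsmul := zsmulRec

instance : Module 𝕜 (GradedMap 𝕜 V W d) where
  one_smul F := ext' fun h x => by simp
  mul_smul a b F := ext' fun h x => by simp [mul_smul]
  smul_zero a := ext' fun h x => by simp
  smul_add a F G := ext' fun h x => by simp
  add_smul a b F := ext' fun h x => by simp [add_smul]
  zero_smul F := ext' fun h x => by simp

end GradedMap

/-- Graded commutative associative unital algebras over `𝕜`. -/
structure GAlg (𝕜 : Type*) [Field 𝕜] where
  obj : ℤ → Type v
  [grp : ∀ i, AddCommGroup (obj i)]
  [mod : ∀ i, Module 𝕜 (obj i)]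
  mul : ∀ {i j k : ℤ}, i + j = k → (obj i →ₗ[𝕜] obj j →ₗ[𝕜] obj k)
  one : obj 0
  mul_assoc : ∀ {i j k ij jk n : ℤ} (h₁ : i + j = ij) (h₂ : ij + k = n) (h₃ : j + k = jk)
    (h₄ : i + jk = n) (a : obj i) (b : obj j) (c : obj k),
    mul h₂ (mul h₁ a b) c = mul h₄ a (mul h₃ b c)
  one_mul : ∀ {i : ℤ} (a : obj i), mul (zero_add i) one a = a
  mul_comm : ∀ {i j k : ℤ} (h : i + j = k) (h' : j + i = k) (a : obj i) (b : obj j),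
    mul h a b = (i * j).negOnePow • mul h' b a

attribute [instance] GAlg.grp GAlg.mod

/-- Graded (left) modules over a graded algebra. -/
structure GMod {𝕜 : Type*} [Field 𝕜] (A : GAlg.{v} 𝕜) where
  obj : ℤ → Type w
  [grp : ∀ i, AddCommGroup (obj i)]
  [mod : ∀ i, Module 𝕜 (obj i)]
  smul : ∀ {i j k : ℤ}, i + j = k → (A.obj i →ₗ[𝕜] obj j →ₗ[𝕜] obj k)
  mul_smul : ∀ {i j k ij jk n : ℤ} (h₁ : i + j = ij) (h₂ : ij + k = n) (h₃ : j + k = jk)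
    (h₄ : i + jk = n) (a : A.obj i) (b : A.obj j) (x : obj k),
    smul h₂ (A.mul h₁ a b) x = smul h₄ a (smul h₃ b x)
  one_smul : ∀ {i : ℤ} (x : obj i), smul (zero_add i) A.one x = x

attribute [instance] GMod.grp GMod.mod

section Algebra

variable {𝕜 : Type*} [Field 𝕜]

theorem map_sign {V W : Type*} [AddCommGroup V] [Module 𝕜 V] [AddCommGroup W] [Module 𝕜 W]
    (F : V →ₗ[𝕜] W) (n : ℤ) (x : V) : F (n.negOnePow • x) = n.negOnePow • F x := by
  rcases Int.even_or_odd n with h | h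
  · simp [Int.negOnePow_even _ h]
  · simp [Int.negOnePow_odd _ h]

theorem map_sign₂ {V W X : Type*} [AddCommGroup V] [Module 𝕜 V] [AddCommGroup W] [Module 𝕜 W]
    [AddCommGroup X] [Module 𝕜 X] (F : V →ₗ[𝕜] W →ₗ[𝕜] X) (n : ℤ) (x : V) (y : W) :
    F (n.negOnePow • x) y = n.negOnePow • F x y := by
  rw [map_sign]
  rcases Int.even_or_odd n with h | h
  · simp [Int.negOnePow_even _ h]
  · simp [Int.negOnePow_odd _ h]

theorem sign_smul_comm {V : Type*} [AddCommGroup V] [Module 𝕜 V] (c : 𝕜) (n : ℤ) (x : V) :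
    n.negOnePow • c • x = c • n.negOnePow • x := by
  rcases Int.even_or_odd n with h | h
  · simp [Int.negOnePow_even _ h]
  · simp [Int.negOnePow_odd _ h]

theorem sign_sign {V : Type*} [AddCommGroup V] (m n : ℤ) (x : V) :
    m.negOnePow • n.negOnePow • x = (m + n).negOnePow • x := by
  rw [Int.negOnePow_add, mul_smul]

theorem GAlg.mul_mul_comm (A : GAlg.{v} 𝕜) {i j k ik jk n : ℤ} (h₁ : j + k = jk)
    (h₂ : i + jk = n) (h₃ : i + k = ik) (h₄ : j + ik = n)
    (a : A.obj i) (b : A.obj j) (c : A.obj k) :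
    A.mul h₂ a (A.mul h₁ b c) = (i * j).negOnePow • A.mul h₄ b (A.mul h₃ a c) := by
  rw [← A.mul_assoc (ij := i + j) rfl (by omega) h₁ h₂, ← A.mul_assoc (ij := i + j) (by omega)
    (by omega) h₃ h₄, A.mul_comm rfl (by omega) a b, map_sign₂]

theorem GMod.smul_smul_comm {A : GAlg.{v} 𝕜} (N : GMod.{v, w} A) {i j k ik jk n : ℤ}
    (h₁ : j + k = jk) (h₂ : i + jk = n) (h₃ : i + k = ik) (h₄ : j + ik = n)
    (a : A.obj i) (b : A.obj j) (c : N.obj k) :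
    N.smul h₂ a (N.smul h₁ b c) = (i * j).negOnePow • N.smul h₄ b (N.smul h₃ a c) := by
  rw [← N.mul_smul (ij := i + j) rfl (by omega) h₁ h₂, ← N.mul_smul (ij := i + j) (by omega)
    (by omega) h₃ h₄, A.mul_comm rfl (by omega) a b, map_sign₂]

/-- The `A`-linear maps `N → N'` of degree `d`:
`F (f ψ) = (-1) ^ (|f| d) f F (ψ)`. -/
def GMod.Hom {A : GAlg.{u} 𝕜} (N : GMod.{u, v} A) (N' : GMod.{u, w} A) (d : ℤ) :
    Submodule 𝕜 (GradedMap 𝕜 N.obj N'.obj d) where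
  carrier := {F | ∀ {i j k m n : ℤ} (h₁ : i + j = k) (h₂ : k + d = n) (h₃ : j + d = m)
    (h₄ : i + m = n) (f : A.obj i) (x : N.obj j),
    F.app h₂ (N.smul h₁ f x) = (i * d).negOnePow • N'.smul h₄ f (F.app h₃ x)}
  zero_mem' := by simp
  add_mem' := by
    intro F G hF hG i j k m n h₁ h₂ h₃ h₄ f x
    simp [hF h₁ h₂ h₃ h₄ f x, hG h₁ h₂ h₃ h₄ f x]
  smul_mem' := by
    intro c F hF i j k m n h₁ h₂ h₃ h₄ f x
    simp [hF h₁ h₂ h₃ h₄ f x, sign_smul_comm]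

/-- The `A`-linear maps `N → A` of degree `d`: `α (f ψ) = (-1) ^ (|α| |f|) f α(ψ)`. -/
def GMod.Covector {A : GAlg.{u} 𝕜} (N : GMod.{u, v} A) (d : ℤ) :
    Submodule 𝕜 (GradedMap 𝕜 N.obj A.obj d) where
  carrier := {F | ∀ {i j k m n : ℤ} (h₁ : i + j = k) (h₂ : k + d = n) (h₃ : j + d = m)
    (h₄ : i + m = n) (f : A.obj i) (x : N.obj j),
    F.app h₂ (N.smul h₁ f x) = (d * i).negOnePow • A.mul h₄ f (F.app h₃ x)}
  zero_mem' := by simp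
  add_mem' := by
    intro F G hF hG i j k m n h₁ h₂ h₃ h₄ f x
    simp [hF h₁ h₂ h₃ h₄ f x, hG h₁ h₂ h₃ h₄ f x]
  smul_mem' := by
    intro c F hF i j k m n h₁ h₂ h₃ h₄ f x
    simp [hF h₁ h₂ h₃ h₄ f x, sign_smul_comm]

/-- The dual module of `A`-linear maps `N → A`, with `(f α)(ψ) = f α(ψ)`. -/
def GMod.dual {A : GAlg.{u} 𝕜} (N : GMod.{u, v} A) : GMod A where
  obj d := N.Covector d
  smul {i j k} h := LinearMap.mk₂ 𝕜
    (fun f α => ⟨⟨fun {a b} hab => (A.mul (show i + (a + j) = b by omega) f).comp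
        (α.1.app (k := a + j) rfl)⟩, by
      intro a b c d e h₁ h₂ h₃ h₄ g x
      simp only [LinearMap.comp_apply]
      rw [α.2 h₁ rfl rfl (show a + (b + j) = c + j by omega) g x, map_sign,
        A.mul_mul_comm _ _ (show i + (b + j) = d by omega) (show a + d = e by omega), sign_sign]
      congr 2
      subst h
      ring⟩)
    (by intros; refine Subtype.ext (GradedMap.ext' fun _ _ => ?_); simp)
    (by intros; refine Subtype.ext (GradedMap.ext' fun _ _ => ?_); simp)
    (by intros; refine Subtype.ext (GradedMap.ext' fun _ _ => ?_); simp)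
    (by intros; refine Subtype.ext (GradedMap.ext' fun _ _ => ?_); simp)
  mul_smul := by
    intro i j k ij jk n h₁ h₂ h₃ h₄ a b α
    refine Subtype.ext (GradedMap.ext' fun {p q} hpq x => ?_)
    subst h₃
    exact A.mul_assoc h₁ (by omega) (by omega) (by omega) a b _
  one_smul := by
    intro i α
    refine Subtype.ext (GradedMap.ext' fun {p q} hpq x => ?_)
    subst hpq
    exact A.one_mul _

/-- The graded derivations of `A` of degree `d`:
`X (f g) = X(f) g + (-1) ^ (|X| |f|) f X(g)`. -/
def GAlg.Derivation (A : GAlg.{u} 𝕜) (d : ℤ) : Submodule 𝕜 (GradedMap 𝕜 A.obj A.obj d) where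
  carrier := {X | ∀ {i j k m n p : ℤ} (h₁ : i + j = k) (h₂ : k + d = p) (h₃ : i + d = m)
    (h₄ : m + j = p) (h₅ : j + d = n) (h₆ : i + n = p) (f : A.obj i) (g : A.obj j),
    X.app h₂ (A.mul h₁ f g) =
      A.mul h₄ (X.app h₃ f) g + (d * i).negOnePow • A.mul h₆ f (X.app h₅ g)}
  zero_mem' := by simp
  add_mem' := by
    intro X Y hX hY i j k m n p h₁ h₂ h₃ h₄ h₅ h₆ f g
    simp only [GradedMap.add_app, LinearMap.add_apply, hX h₁ h₂ h₃ h₄ h₅ h₆ f g,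
      hY h₁ h₂ h₃ h₄ h₅ h₆ f g, map_add, smul_add]
    abel
  smul_mem' := by
    intro c X hX i j k m n p h₁ h₂ h₃ h₄ h₅ h₆ f g
    simp [hX h₁ h₂ h₃ h₄ h₅ h₆, sign_smul_comm]

/-- The module of graded derivations of `A`, with `(f X)(g) = f X(g)`. -/
def GAlg.der (A : GAlg.{u} 𝕜) : GMod A where
  obj d := A.Derivation d
  smul {i j k} h := LinearMap.mk₂ 𝕜
    (fun f X => ⟨⟨fun {a b} hab => (A.mul (show i + (a + j) = b by omega) f).comp
        (X.1.app (k := a + j) rfl)⟩, by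
      intro a b c d e p h₁ h₂ h₃ h₄ h₅ h₆ g g'
      simp only [LinearMap.comp_apply]
      rw [X.2 h₁ rfl rfl (show (a + j) + b = c + j by omega) rfl
        (show a + (b + j) = c + j by omega) g g', map_add, map_sign]
      congr 1
      · exact (A.mul_assoc _ _ _ _ f _ g').symm
      · rw [A.mul_mul_comm _ _ (show i + (b + j) = e by omega) h₆, sign_sign]
        congr 2
        subst h
        ring⟩)
    (by intros; refine Subtype.ext (GradedMap.ext' fun _ _ => ?_); simp)
    (by intros; refine Subtype.ext (GradedMap.ext' fun _ _ => ?_); simp)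
    (by intros; refine Subtype.ext (GradedMap.ext' fun _ _ => ?_); simp)
    (by intros; refine Subtype.ext (GradedMap.ext' fun _ _ => ?_); simp)
  mul_smul := by
    intro i j k ij jk n h₁ h₂ h₃ h₄ a b α
    refine Subtype.ext (GradedMap.ext' fun {p q} hpq x => ?_)
    subst h₃
    exact A.mul_assoc h₁ (by omega) (by omega) (by omega) a b _
  one_smul := by
    intro i α
    refine Subtype.ext (GradedMap.ext' fun {p q} hpq x => ?_)
    subst hpq
    exact A.one_mul _

/-- The differential `d f` of a function, a `1`-form (that is, an `A`-linear map on derivations) of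
degree `|f|`, with the sign convention `(d f)(X) = (-1) ^ ((|X| - 1) |f|) X(f)`. -/
def GAlg.diff (A : GAlg.{u} 𝕜) (i : ℤ) : A.obj i →ₗ[𝕜] A.der.Covector i where
  toFun f := ⟨⟨fun {j k} h =>
    { toFun := fun X : A.Derivation j => ((j - 1) * i).negOnePow •
        X.1.app (show i + j = k by omega) f
      map_add' := fun X Y => smul_add _ (X.1.app _ f) (Y.1.app _ f)
      map_smul' := fun c X => sign_smul_comm c _ _ }⟩, by
    intro a b c m n h₁ h₂ h₃ h₄ g X
    obtain rfl : i + b = m := by omega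
    change ((c - 1) * i).negOnePow • A.mul h₄ g (X.1.app rfl f) =
      (i * a).negOnePow • A.mul h₄ g (((b - 1) * i).negOnePow • X.1.app rfl f)
    rw [map_sign, sign_sign]
    subst h₁
    congr 2
    ring⟩
  map_add' := by
    intro f g
    refine Subtype.ext (GradedMap.ext' fun {j k} h (X : A.Derivation j) => ?_)
    have e : i + j = k := by omega
    change ((j - 1) * i).negOnePow • X.1.app e (f + g) =
      ((j - 1) * i).negOnePow • X.1.app e f + ((j - 1) * i).negOnePow • X.1.app e g
    rw [map_add, smul_add]
  map_smul' := by
    intro c f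
    refine Subtype.ext (GradedMap.ext' fun {j k} h (X : A.Derivation j) => ?_)
    have e : i + j = k := by omega
    change ((j - 1) * i).negOnePow • X.1.app e (c • f) =
      c • ((j - 1) * i).negOnePow • X.1.app e f
    rw [map_smul, sign_smul_comm]

/-- The transpose `ρᵀ(α)(ψ) = (-1) ^ (|α| ℓ) α(ρ(ψ))` of an `A`-linear map `ρ` of degree `ℓ`. -/
def GMod.transpose {A : GAlg.{u} 𝕜} {N : GMod.{u, v} A} {N' : GMod.{u, w} A} {ℓ : ℤ}
    (ρ : N.Hom N' ℓ) {d k : ℤ} (h : d + ℓ = k) : N'.Covector d →ₗ[𝕜] N.Covector k where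
  toFun α := ⟨⟨fun {i j} hij =>
    { toFun := fun x => (d * ℓ).negOnePow •
        α.1.app (show (i + ℓ) + d = j by omega) (ρ.1.app rfl x)
      map_add' := fun x y => by simp only [map_add, smul_add]
      map_smul' := fun c x => by simp only [map_smul, sign_smul_comm, RingHom.id_apply] }⟩, by
    intro a b c m n h₁ h₂ h₃ h₄ g x
    simp only [LinearMap.coe_mk, AddHom.coe_mk]
    rw [ρ.2 h₁ rfl rfl (show a + (b + ℓ) = c + ℓ by omega) g x, map_sign,
      α.2 (show a + (b + ℓ) = c + ℓ by omega) (show c + ℓ + d = n by omega)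
        (show b + ℓ + d = m by omega) h₄ g (ρ.1.app rfl x), map_sign,
      sign_sign, sign_sign, sign_sign]
    subst h
    congr 2
    ring⟩
  map_add' α β := Subtype.ext <| GradedMap.ext' fun _ _ => by simp
  map_smul' c α := Subtype.ext <| GradedMap.ext' fun _ _ => by simp [sign_smul_comm]

end Algebra

/-! ## Sheaves of graded algebras and of graded modules -/

/-- Sheaves of graded commutative associative algebras on `M`. -/
structure GAlgSheaf (𝕜 : Type*) [Field 𝕜] (M : Type u) [TopologicalSpace M] where
  sec : Opens M → GAlg.{v} 𝕜
  res : ∀ {U V : Opens M}, V ≤ U → ∀ {i : ℤ}, (sec U).obj i →ₗ[𝕜] (sec V).obj i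
  res_self : ∀ {U : Opens M} {i : ℤ} (f : (sec U).obj i), res le_rfl f = f
  res_res : ∀ {U V W : Opens M} (h : V ≤ U) (h' : W ≤ V) {i : ℤ} (f : (sec U).obj i),
    res h' (res h f) = res (h'.trans h) f
  res_mul : ∀ {U V : Opens M} (hV : V ≤ U) {i j k : ℤ} (h : i + j = k) (f : (sec U).obj i)
    (g : (sec U).obj j), res hV ((sec U).mul h f g) = (sec V).mul h (res hV f) (res hV g)
  res_one : ∀ {U V : Opens M} (hV : V ≤ U), res hV (sec U).one = (sec V).one
  glue : ∀ (W : Opens M) (𝒰 : Set (Opens M)) (hle : ∀ U : 𝒰, U.1 ≤ W), W ≤ sSup 𝒰 →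
    ∀ (i : ℤ) (s : ∀ U : 𝒰, (sec U.1).obj i),
    (∀ U V : 𝒰, res (inf_le_left : U.1 ⊓ V.1 ≤ U.1) (s U) =
      res (inf_le_right : U.1 ⊓ V.1 ≤ V.1) (s V)) →
    ∃! t : (sec W).obj i, ∀ U : 𝒰, res (hle U) t = s U

section Sheaves

variable {𝕜 : Type*} [Field 𝕜] {M : Type u} [TopologicalSpace M]

/-- Sheaves of graded modules over a sheaf of graded algebras. -/
structure GModSheaf (A : GAlgSheaf.{u, v} 𝕜 M) where
  sec : ∀ U : Opens M, GMod.{v, w} (A.sec U)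
  res : ∀ {U V : Opens M}, V ≤ U → ∀ {i : ℤ}, (sec U).obj i →ₗ[𝕜] (sec V).obj i
  res_self : ∀ {U : Opens M} {i : ℤ} (x : (sec U).obj i), res le_rfl x = x
  res_res : ∀ {U V W : Opens M} (h : V ≤ U) (h' : W ≤ V) {i : ℤ} (x : (sec U).obj i),
    res h' (res h x) = res (h'.trans h) x
  res_smul : ∀ {U V : Opens M} (hV : V ≤ U) {i j k : ℤ} (h : i + j = k) (f : (A.sec U).obj i)
    (x : (sec U).obj j), res hV ((sec U).smul h f x) = (sec V).smul h (A.res hV f) (res hV x)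
  glue : ∀ (W : Opens M) (𝒰 : Set (Opens M)) (hle : ∀ U : 𝒰, U.1 ≤ W), W ≤ sSup 𝒰 →
    ∀ (i : ℤ) (s : ∀ U : 𝒰, (sec U.1).obj i),
    (∀ U V : 𝒰, res (inf_le_left : U.1 ⊓ V.1 ≤ U.1) (s U) =
      res (inf_le_right : U.1 ⊓ V.1 ≤ V.1) (s V)) →
    ∃! t : (sec W).obj i, ∀ U : 𝒰, res (hle U) t = s U

/-- `Φ` is a local frame over `U` for the family `S` of submodules of sections: every section of `S`
over an open `V ⊆ U` is uniquely `∑ f l • Φ l` with `|f l| + |Φ l|` equal to its degree. -/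
def GModSheaf.IsLocalFrame {A : GAlgSheaf.{u, v} 𝕜 M} (E : GModSheaf.{u, v, w} A)
    (S : ∀ (U : Opens M) (i : ℤ), Submodule 𝕜 ((E.sec U).obj i)) (U : Opens M) {r : ℕ}
    (deg : Fin r → ℤ) (Φ : ∀ l, (E.sec U).obj (deg l)) : Prop :=
  (∀ l, Φ l ∈ S U (deg l)) ∧
  ∀ (V : Opens M) (hV : V ≤ U) (i : ℤ), ∀ ψ ∈ S V i,
    ∃! f : ∀ l, (A.sec V).obj (i - deg l),
      ψ = ∑ l, (E.sec V).smul (sub_add_cancel i (deg l)) (f l) (E.res hV (Φ l))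

/-- Graded vector bundles, given by their sheaves of sections: locally freely and finitely generated
sheaves of graded modules of constant graded rank. -/
structure GradedVectorBundle (A : GAlgSheaf.{u, v} 𝕜 M) extends GModSheaf.{u, v, w} A where
  rank : ℤ →₀ ℕ
  locally_free : ∀ m : M, ∃ U : Opens M, m ∈ U ∧ ∃ (r : ℕ) (deg : Fin r → ℤ)
    (Φ : ∀ l, (sec U).obj (deg l)), (∀ j, Fintype.card {l // deg l = j} = rank j) ∧
      toGModSheaf.IsLocalFrame (fun _ _ => ⊤) U deg Φ

/-- Subbundles: subsheaves of graded submodules which locally admit adapted frames, that is, local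
frames of `E` whose first `q` members form a local frame of the subsheaf. -/
structure Subbundle {A : GAlgSheaf.{u, v} 𝕜 M} (E : GradedVectorBundle.{u, v, w} A) where
  sec : ∀ (U : Opens M) (i : ℤ), Submodule 𝕜 ((E.sec U).obj i)
  smul_mem : ∀ {U : Opens M} {i j k : ℤ} (h : i + j = k) (f : (A.sec U).obj i)
    {x : (E.sec U).obj j}, x ∈ sec U j → (E.sec U).smul h f x ∈ sec U k
  res_mem : ∀ {U V : Opens M} (hV : V ≤ U) {i : ℤ} {x : (E.sec U).obj i},
    x ∈ sec U i → E.res hV x ∈ sec V i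
  mem_of_locally : ∀ (W : Opens M) (𝒰 : Set (Opens M)) (hle : ∀ U : 𝒰, U.1 ≤ W), W ≤ sSup 𝒰 →
    ∀ (i : ℤ) (x : (E.sec W).obj i), (∀ U : 𝒰, E.res (hle U) x ∈ sec U.1 i) → x ∈ sec W i
  rank : ℤ →₀ ℕ
  locally_adapted : ∀ m : M, ∃ U : Opens M, m ∈ U ∧ ∃ (r q : ℕ) (hq : q ≤ r) (deg : Fin r → ℤ)
    (Φ : ∀ l, (E.sec U).obj (deg l)),
      (∀ j, Fintype.card {l // deg l = j} = E.rank j) ∧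
      (∀ j, Fintype.card {l : Fin q // deg (Fin.castLE hq l) = j} = rank j) ∧
      E.IsLocalFrame (fun _ _ => ⊤) U deg Φ ∧
      E.IsLocalFrame sec U (fun l : Fin q => deg (Fin.castLE hq l)) (fun l => Φ (Fin.castLE hq l))

/-- Vector bundle maps `E → E'` of degree `d`: `C^∞(M)`-linear maps of global sections. -/
abbrev VBMap {A : GAlgSheaf.{u, v} 𝕜 M} (E E' : GradedVectorBundle.{u, v, w} A) (d : ℤ) :=
  (E.sec ⊤).Hom (E'.sec ⊤) d

/-- A vector bundle map together with its restrictions to open sets, which form a morphism of sheaves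
of graded modules. -/
structure VBMap.Restrictions {A : GAlgSheaf.{u, v} 𝕜 M} {E E' : GradedVectorBundle.{u, v, w} A}
    {d : ℤ} (F : VBMap E E' d) where
  on : ∀ U : Opens M, (E.sec U).Hom (E'.sec U) d
  res_on : ∀ {U V : Opens M} (hV : V ≤ U) {i k : ℤ} (h : i + d = k) (x : (E.sec U).obj i),
    E'.res hV ((on U).1.app h x) = (on V).1.app h (E.res hV x)
  on_top : on ⊤ = F

end Sheaves

/-! ## Graded manifolds -/

/-- Points of the model space of the body. -/
abbrev BodyModel (n : ℕ) := EuclideanSpace ℝ (Fin n)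

/-- Smooth real functions on an open subset of `ℝⁿ`. -/
abbrev SmoothOn {n : ℕ} (V : Opens (BodyModel n)) := C^∞⟮𝓘(ℝ, BodyModel n), V; ℝ⟯

section Domain

variable {n s : ℕ} (deg : Fin s → ℤ)

/-- The multi-indices `p` for which `ξ ^ p` is a monomial of degree `d`; the variable `ξ_μ` has degree
`deg μ`, and occurs at most once if this degree is odd. -/
def IsMonomial (d : ℤ) (p : Fin s → ℕ) : Prop :=
  ∑ μ, (p μ : ℤ) * deg μ = d ∧ ∀ μ, Odd (deg μ) → p μ ≤ 1

/-- Functions of degree `d` on the graded domain over `V`: formal power series `∑ f_p ξ ^ p` in the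
graded variables with smooth coefficients. -/
def DomainFun (V : Opens (BodyModel n)) (d : ℤ) : Submodule ℝ ((Fin s → ℕ) → SmoothOn V) where
  carrier := {f | ∀ p, ¬ IsMonomial deg d p → f p = 0}
  zero_mem' := fun _ _ => rfl
  add_mem' := by
    intro f g hf hg p hp
    rw [Pi.add_apply, hf p hp, hg p hp, add_zero]
  smul_mem' := by
    intro c f hf p hp
    rw [Pi.smul_apply, hf p hp, smul_zero]

/-- The sign obtained by reordering `ξ ^ q ξ ^ r` into `ξ ^ (q + r)`: each factor `ξ_μ` of `ξ ^ r` is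
moved past the factors `ξ_ν` of `ξ ^ q` with `μ < ν`. -/
def reorderSign (q r : Fin s → ℕ) : ℤˣ :=
  Int.negOnePow (∑ ν, ∑ μ ∈ Finset.univ.filter (· < ν), (q ν * deg ν) * (r μ * deg μ))

open Classical in
/-- The product of power series,
`(f g)_p = ∑_{q ≤ p} ε(q, p - q) f_q g_{p - q}`. -/
def DomainFun.mul {V : Opens (BodyModel n)} {i j : ℤ} (k : ℤ) (f : DomainFun deg V i)
    (g : DomainFun deg V j) : DomainFun deg V k :=
  ⟨fun p => if IsMonomial deg k p then
      ∑ q ∈ Finset.Iic p, reorderSign deg q (p - q) • (f.1 q * g.1 (p - q))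
    else 0, fun _ hp => if_neg hp⟩

/-- The unit power series. -/
def DomainFun.one (V : Opens (BodyModel n)) : DomainFun deg V 0 :=
  ⟨fun p => if p = 0 then 1 else 0, by
    intro p hp
    refine if_neg ?_
    rintro rfl
    exact hp ⟨by simp, fun _ _ => Nat.zero_le _⟩⟩

/-- The restriction of power series, by restricting the coefficients. -/
def DomainFun.res {V W : Opens (BodyModel n)} (h : W ≤ V) {i : ℤ} (f : DomainFun deg V i) :
    DomainFun deg W i :=
  ⟨fun p => ContMDiffMap.restrictRingHom 𝓘(ℝ, BodyModel n) 𝓘(ℝ, ℝ) ℝ h (f.1 p), by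
    intro p hp
    change ContMDiffMap.restrictRingHom 𝓘(ℝ, BodyModel n) 𝓘(ℝ, ℝ) ℝ h (f.1 p) = 0
    rw [f.2 p hp, map_zero]⟩

end Domain

section Manifold

variable {M : Type u} [TopologicalSpace M]

/-- The open subset `φ⁻¹(V)` of the domain of a chart. -/
def chartPreimage {n : ℕ} (φ : OpenPartialHomeomorph M (BodyModel n)) (V : Opens (BodyModel n)) :
    Opens M :=
  ⟨φ.source ∩ φ ⁻¹' V, φ.isOpen_inter_preimage V.2⟩

theorem chartPreimage_mono {n : ℕ} (φ : OpenPartialHomeomorph M (BodyModel n))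
    {V W : Opens (BodyModel n)} (h : W ≤ V) : chartPreimage φ W ≤ chartPreimage φ V :=
  fun _ hx => ⟨hx.1, h hx.2⟩

/-- Graded charts: isomorphisms of an open part of `(M, A)` with a graded domain, given by a
homeomorphism `φ` onto an open subset of `ℝⁿ` and an isomorphism from the sheaf of graded algebras of the
graded domain to the push-forward of `A`. -/
structure GradedChart (A : GAlgSheaf.{u, v} ℝ M) (n : ℕ) {s : ℕ} (deg : Fin s → ℤ) where
  φ : OpenPartialHomeomorph M (BodyModel n)
  pull : ∀ V : Opens (BodyModel n), (V : Set (BodyModel n)) ⊆ φ.target → ∀ i : ℤ,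
    DomainFun deg V i ≃ₗ[ℝ] (A.sec (chartPreimage φ V)).obj i
  pull_mul : ∀ (V : Opens (BodyModel n)) (hV : (V : Set (BodyModel n)) ⊆ φ.target) {i j k : ℤ}
    (h : i + j = k) (f : DomainFun deg V i) (g : DomainFun deg V j),
    pull V hV k (DomainFun.mul deg k f g) =
      (A.sec (chartPreimage φ V)).mul h (pull V hV i f) (pull V hV j g)
  pull_one : ∀ (V : Opens (BodyModel n)) (hV : (V : Set (BodyModel n)) ⊆ φ.target),
    pull V hV 0 (DomainFun.one deg V) = (A.sec (chartPreimage φ V)).one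
  pull_res : ∀ (V W : Opens (BodyModel n)) (hV : (V : Set (BodyModel n)) ⊆ φ.target)
    (h : W ≤ V) (i : ℤ) (f : DomainFun deg V i),
    pull W (Set.Subset.trans h hV) i (DomainFun.res deg h f) =
      A.res (chartPreimage_mono φ h) (pull V hV i f)

/-- The germ at `m` of the section `f` is invertible. -/
def GAlgSheaf.IsUnitAt {𝕜 : Type*} [Field 𝕜] (A : GAlgSheaf.{u, v} 𝕜 M) (m : M) {U : Opens M}
    {i : ℤ} (f : (A.sec U).obj i) : Prop :=
  ∃ (V : Opens M) (hV : V ≤ U), m ∈ V ∧ ∃ g : (A.sec V).obj (-i),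
    (A.sec V).mul (add_neg_cancel i) (A.res hV f) g = (A.sec V).one

/-- All stalks are local graded rings: they are non-zero, and the non-invertible elements of each degree
are closed under addition. -/
def GAlgSheaf.HasLocalStalks {𝕜 : Type*} [Field 𝕜] (A : GAlgSheaf.{u, v} 𝕜 M) : Prop :=
  ∀ (m : M) (U : Opens M), m ∈ U → (A.sec U).one ≠ 0 ∧
    ∀ (i : ℤ) (f g : (A.sec U).obj i), A.IsUnitAt m (f + g) → A.IsUnitAt m f ∨ A.IsUnitAt m g

/-- Graded manifolds.  The graded dimension `(n_j)` is recorded as `n₀ = bodyDim` together with the list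
of the (non-zero) degrees of the purely graded coordinates, so `n_j` is the number of occurrences
of `j` in this list for `j ≠ 0`. -/
structure GradedManifold (M : Type u) [TopologicalSpace M] [T2Space M]
    [SecondCountableTopology M] where
  sheaf : GAlgSheaf.{u, v} ℝ M
  hasLocalStalks : sheaf.HasLocalStalks
  bodyDim : ℕ
  numGraded : ℕ
  coordDeg : Fin numGraded → ℤ
  coordDeg_ne_zero : ∀ μ, coordDeg μ ≠ 0
  exists_chart : ∀ m : M, ∃ c : GradedChart sheaf bodyDim coordDeg, m ∈ c.φ.source

end Manifold

/-! ## Graded Courant algebroids -/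

section Courant

variable {M : Type u} [TopologicalSpace M] {A : GAlgSheaf.{u, v} ℝ M}

/-- The data of a graded Courant algebroid of degree `ℓ`: the anchor `ρ : E → TM` (where the sections
of `TM` are the graded derivations of the functions), the isomorphism `g : E → E*`, both of
degree `ℓ`, and the bracket. -/
structure CourantData (E : GradedVectorBundle.{u, v, w} A) (ℓ : ℤ) where
  anchor : (E.sec ⊤).Hom (A.sec ⊤).der ℓ
  metric : (E.sec ⊤).Hom (E.sec ⊤).dual ℓ
  metric_bijective : ∀ {i k : ℤ} (h : i + ℓ = k), Function.Bijective (metric.1.app h)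
  bracket : ∀ {i j k : ℤ}, i + j + ℓ = k →
    ((E.sec ⊤).obj i →ₗ[ℝ] (E.sec ⊤).obj j →ₗ[ℝ] (E.sec ⊤).obj k)

namespace CourantData

variable {E : GradedVectorBundle.{u, v, w} A} {ℓ : ℤ} (C : CourantData E ℓ)

/-- `ρ(ψ)` as a derivation. -/
def anchorDer {i k : ℤ} (h : i + ℓ = k) : (E.sec ⊤).obj i →ₗ[ℝ] (A.sec ⊤).Derivation k :=
  C.anchor.1.app h

/-- `g(ψ)` as a linear form on sections. -/
def metricForm {i k : ℤ} (h : i + ℓ = k) : (E.sec ⊤).obj i →ₗ[ℝ] (E.sec ⊤).Covector k :=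
  C.metric.1.app h

/-- `ρ̂(ψ)(f) = (-1) ^ ((|ψ| + ℓ) ℓ) ρ(ψ)(f)`. -/
def anchorHat {i j k : ℤ} (h : i + j + ℓ = k) (ψ : (E.sec ⊤).obj i) (f : (A.sec ⊤).obj j) :
    (A.sec ⊤).obj k :=
  ((i + ℓ) * ℓ).negOnePow •
    (C.anchorDer rfl ψ).1.app (show j + (i + ℓ) = k by omega) f

/-- `⟨ψ, ψ'⟩ = (-1) ^ ((|ψ| + ℓ) ℓ) [g(ψ)](ψ')`. -/
def pairing {i j k : ℤ} (h : i + j + ℓ = k) :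
    (E.sec ⊤).obj i →ₗ[ℝ] (E.sec ⊤).obj j →ₗ[ℝ] (A.sec ⊤).obj k :=
  LinearMap.mk₂ ℝ
    (fun ψ ψ' => ((i + ℓ) * ℓ).negOnePow •
      (C.metricForm rfl ψ).1.app (show j + (i + ℓ) = k by omega) ψ')
    (by intros; simp [smul_add]) (by intros; simp [sign_smul_comm])
    (by intros; simp [smul_add]) (by intros; simp [sign_smul_comm])

/-- `D = g⁻¹ ∘ ρᵀ ∘ d`. -/
def D (i : ℤ) (f : (A.sec ⊤).obj i) : (E.sec ⊤).obj i :=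
  (LinearEquiv.ofBijective (C.metricForm (k := i + ℓ) rfl) (C.metric_bijective rfl)).symm
    (GMod.transpose C.anchor rfl ((A.sec ⊤).diff i f))

end CourantData

/-- Graded Courant algebroids of degree `ℓ`. -/
structure GradedCourantAlgebroid (E : GradedVectorBundle.{u, v, w} A) (ℓ : ℤ) extends
    CourantData E ℓ where
  pairing_symm : ∀ {i j k : ℤ} (h : i + j + ℓ = k) (h' : j + i + ℓ = k) (ψ : (E.sec ⊤).obj i)
    (ψ' : (E.sec ⊤).obj j),
    toCourantData.pairing h ψ ψ' =
      ((i + ℓ) * (j + ℓ)).negOnePow • toCourantData.pairing h' ψ' ψ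
  pairing_bracket : ∀ {a b c ab ac bc n : ℤ} (hab : a + b + ℓ = ab) (hac : a + c + ℓ = ac)
    (hbc : b + c + ℓ = bc) (h₁ : a + bc + ℓ = n) (h₂ : ab + c + ℓ = n) (h₃ : b + ac + ℓ = n)
    (ψ : (E.sec ⊤).obj a) (ψ' : (E.sec ⊤).obj b) (ψ'' : (E.sec ⊤).obj c),
    toCourantData.anchorHat h₁ ψ (toCourantData.pairing hbc ψ' ψ'') =
      toCourantData.pairing h₂ (bracket hab ψ ψ') ψ'' +
        ((a + ℓ) * (b + ℓ)).negOnePow • toCourantData.pairing h₃ ψ' (bracket hac ψ ψ'')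
  bracket_symm : ∀ {a b k : ℤ} (h : a + b + ℓ = k) (h' : b + a + ℓ = k)
    (ψ : (E.sec ⊤).obj a) (ψ' : (E.sec ⊤).obj b),
    bracket h ψ ψ' + ((a + ℓ) * (b + ℓ)).negOnePow • bracket h' ψ' ψ =
      (a + b).negOnePow • toCourantData.D k (toCourantData.pairing h ψ ψ')
  jacobi : ∀ {a b c ab ac bc n : ℤ} (hab : a + b + ℓ = ab) (hac : a + c + ℓ = ac)
    (hbc : b + c + ℓ = bc) (h₁ : a + bc + ℓ = n) (h₂ : ab + c + ℓ = n) (h₃ : b + ac + ℓ = n)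
    (ψ : (E.sec ⊤).obj a) (ψ' : (E.sec ⊤).obj b) (ψ'' : (E.sec ⊤).obj c),
    bracket h₁ ψ (bracket hbc ψ' ψ'') =
      bracket h₂ (bracket hab ψ ψ') ψ'' +
        ((a + ℓ) * (b + ℓ)).negOnePow • bracket h₃ ψ' (bracket hac ψ ψ'')

namespace CourantData

variable {E : GradedVectorBundle.{u, v, w} A} {ℓ : ℤ} (C : CourantData E ℓ)

/-- `J` is orthogonal: `⟨J ψ, J ψ'⟩ = ⟨ψ, ψ'⟩`. -/
def IsOrthogonal (J : VBMap E E 0) : Prop :=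
  ∀ {i j k : ℤ} (h : i + j + ℓ = k) (ψ : (E.sec ⊤).obj i) (ψ' : (E.sec ⊤).obj j),
    C.pairing h (J.1.app (add_zero i) ψ) (J.1.app (add_zero j) ψ') = C.pairing h ψ ψ'

/-- The Nijenhuis tensor
`N_J(ψ, ψ') = [ψ, ψ'] - [J ψ, J ψ'] + J ([ψ, J ψ'] + [J ψ, ψ'])`. -/
def nijenhuis (J : VBMap E E 0) {i j k : ℤ} (h : i + j + ℓ = k) (ψ : (E.sec ⊤).obj i)
    (ψ' : (E.sec ⊤).obj j) : (E.sec ⊤).obj k :=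
  C.bracket h ψ ψ' - C.bracket h (J.1.app (add_zero i) ψ) (J.1.app (add_zero j) ψ') +
    J.1.app (add_zero k) (C.bracket h ψ (J.1.app (add_zero j) ψ') +
      C.bracket h (J.1.app (add_zero i) ψ) ψ')

end CourantData

end Courant

/-! ## Complexification -/

/-- The complexification of a real vector space; the pair `(x, y)` stands for `x + i y`. -/
def Cpx (V : Type v) := V × V

namespace Cpx

section Basic

variable {V : Type v}

/-- The element `x + i y`. -/
def mk (x y : V) : Cpx V := (x, y)

/-- The real part. -/
def re (z : Cpx V) : V := z.1

/-- The imaginary part. -/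
def im (z : Cpx V) : V := z.2

@[ext] theorem ext {z z' : Cpx V} (h : z.re = z'.re) (h' : z.im = z'.im) : z = z' := Prod.ext h h'

@[simp] theorem re_mk (x y : V) : (mk x y).re = x := rfl
@[simp] theorem im_mk (x y : V) : (mk x y).im = y := rfl

variable [AddCommGroup V]

instance : AddCommGroup (Cpx V) := inferInstanceAs (AddCommGroup (V × V))

@[simp] theorem re_zero : (0 : Cpx V).re = 0 := rfl
@[simp] theorem im_zero : (0 : Cpx V).im = 0 := rfl
@[simp] theorem re_add (z z' : Cpx V) : (z + z').re = z.re + z'.re := rfl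
@[simp] theorem im_add (z z' : Cpx V) : (z + z').im = z.im + z'.im := rfl
@[simp] theorem re_sign (n : ℤ) (z : Cpx V) : (n.negOnePow • z).re = n.negOnePow • z.re := rfl
@[simp] theorem im_sign (n : ℤ) (z : Cpx V) : (n.negOnePow • z).im = n.negOnePow • z.im := rfl

end Basic

variable {V W X : Type*} [AddCommGroup V] [Module ℝ V] [AddCommGroup W] [Module ℝ W]
  [AddCommGroup X] [Module ℝ X]

/-- `(a + i b)(x + i y) = (a x - b y) + i (a y + b x)`. -/
instance : SMul ℂ (Cpx V) :=
  ⟨fun c z => mk (c.re • z.re - c.im • z.im) (c.re • z.im + c.im • z.re)⟩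

@[simp] theorem re_smul (c : ℂ) (z : Cpx V) : (c • z).re = c.re • z.re - c.im • z.im := rfl
@[simp] theorem im_smul (c : ℂ) (z : Cpx V) : (c • z).im = c.re • z.im + c.im • z.re := rfl

instance : Module ℂ (Cpx V) where
  one_smul z := by ext <;> simp
  mul_smul a b z := by
    ext <;> simp only [re_smul, im_smul, Complex.mul_re, Complex.mul_im] <;> module
  smul_zero a := by ext <;> simp
  smul_add a z z' := by ext <;> simp only [re_smul, im_smul, re_add, im_add] <;> module
  add_smul a b z := by
    ext <;> simp only [re_smul, im_smul, re_add, im_add, Complex.add_re, Complex.add_im] <;> module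
  zero_smul z := by ext <;> simp

/-- The complex linear extension of a real linear map. -/
def map (F : V →ₗ[ℝ] W) : Cpx V →ₗ[ℂ] Cpx W where
  toFun z := mk (F z.re) (F z.im)
  map_add' z z' := by ext <;> simp
  map_smul' c z := by ext <;> simp

@[simp] theorem re_map (F : V →ₗ[ℝ] W) (z : Cpx V) : (map F z).re = F z.re := rfl
@[simp] theorem im_map (F : V →ₗ[ℝ] W) (z : Cpx V) : (map F z).im = F z.im := rfl

/-- The complex bilinear extension of a real bilinear map. -/
def map₂ (B : V →ₗ[ℝ] W →ₗ[ℝ] X) : Cpx V →ₗ[ℂ] Cpx W →ₗ[ℂ] Cpx X :=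
  LinearMap.mk₂ ℂ
    (fun z w => mk (B z.re w.re - B z.im w.im) (B z.re w.im + B z.im w.re))
    (by intros; ext <;> simp <;> abel)
    (by intros; ext <;> simp <;> module)
    (by intros; ext <;> simp <;> abel)
    (by intros; ext <;> simp <;> module)

@[simp] theorem re_map₂ (B : V →ₗ[ℝ] W →ₗ[ℝ] X) (z : Cpx V) (w : Cpx W) :
    (map₂ B z w).re = B z.re w.re - B z.im w.im := rfl
@[simp] theorem im_map₂ (B : V →ₗ[ℝ] W →ₗ[ℝ] X) (z : Cpx V) (w : Cpx W) :
    (map₂ B z w).im = B z.re w.im + B z.im w.re := rfl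

/-- Complex conjugation `x + i y ↦ x - i y`. -/
def conj : Cpx V →ₛₗ[starRingEnd ℂ] Cpx V where
  toFun z := mk z.re (-z.im)
  map_add' z z' := by ext <;> simp; abel
  map_smul' c z := by ext <;> simp; abel

end Cpx

/-- The complexification of a real graded algebra. -/
@[reducible]
def GAlg.cpx (A : GAlg.{v} ℝ) : GAlg.{v} ℂ where
  obj i := Cpx (A.obj i)
  mul h := Cpx.map₂ (A.mul h)
  one := Cpx.mk A.one 0
  mul_assoc h₁ h₂ h₃ h₄ a b c := by
    ext <;> simp [A.mul_assoc h₁ h₂ h₃ h₄] <;> abel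
  one_mul a := by ext <;> simp [A.one_mul]
  mul_comm h h' a b := by
    ext
    · simp [A.mul_comm h h', smul_sub]
    · simp [A.mul_comm h h', smul_add, add_comm]

/-- The complexification of a graded module. -/
@[reducible]
def GMod.cpx {A : GAlg.{v} ℝ} (N : GMod.{v, w} A) : GMod.{v, w} A.cpx where
  obj i := Cpx (N.obj i)
  smul h := Cpx.map₂ (N.smul h)
  mul_smul h₁ h₂ h₃ h₄ a b c := by
    ext <;> simp [N.mul_smul h₁ h₂ h₃ h₄] <;> abel
  one_smul a := by ext <;> simp [N.one_smul]

theorem Cpx.re_sum {V : Type*} [AddCommGroup V] {ι : Type*} (t : Finset ι) (z : ι → Cpx V) :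
    (∑ l ∈ t, z l).re = ∑ l ∈ t, (z l).re :=
  map_sum (AddMonoidHom.mk' (Cpx.re (V := V)) fun _ _ => rfl) z t

theorem Cpx.im_sum {V : Type*} [AddCommGroup V] {ι : Type*} (t : Finset ι) (z : ι → Cpx V) :
    (∑ l ∈ t, z l).im = ∑ l ∈ t, (z l).im :=
  map_sum (AddMonoidHom.mk' (Cpx.im (V := V)) fun _ _ => rfl) z t

section ComplexBundles

variable {M : Type u} [TopologicalSpace M]

/-- The complexification of a sheaf of real graded algebras. -/
@[reducible]
def GAlgSheaf.cpx (A : GAlgSheaf.{u, v} ℝ M) : GAlgSheaf.{u, v} ℂ M where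
  sec U := (A.sec U).cpx
  res h := Cpx.map (A.res h)
  res_self f := by ext <;> simp [A.res_self]
  res_res := by intros; ext <;> simp [A.res_res]
  res_mul := by intros; ext <;> simp [A.res_mul]
  res_one hV := by ext <;> simp [A.res_one]
  glue W 𝒰 hle hW i s hs := by
    obtain ⟨a, ha, ua⟩ := A.glue W 𝒰 hle hW i (fun U => (s U).re)
      fun U V => congrArg Cpx.re (hs U V)
    obtain ⟨b, hb, ub⟩ := A.glue W 𝒰 hle hW i (fun U => (s U).im)
      fun U V => congrArg Cpx.im (hs U V)
    exact ⟨Cpx.mk a b, fun U => Cpx.ext (ha U) (hb U), fun t ht =>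
      Cpx.ext (ua _ fun U => congrArg Cpx.re (ht U)) (ub _ fun U => congrArg Cpx.im (ht U))⟩

/-- The complexification of a sheaf of real graded modules. -/
@[reducible]
def GModSheaf.cpx {A : GAlgSheaf.{u, v} ℝ M} (E : GModSheaf.{u, v, w} A) :
    GModSheaf.{u, v, w} A.cpx where
  sec U := (E.sec U).cpx
  res h := Cpx.map (E.res h)
  res_self f := by ext <;> simp [E.res_self]
  res_res := by intros; ext <;> simp [E.res_res]
  res_smul := by intros; ext <;> simp [E.res_smul]
  glue W 𝒰 hle hW i s hs := by
    obtain ⟨a, ha, ua⟩ := E.glue W 𝒰 hle hW i (fun U => (s U).re)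
      fun U V => congrArg Cpx.re (hs U V)
    obtain ⟨b, hb, ub⟩ := E.glue W 𝒰 hle hW i (fun U => (s U).im)
      fun U V => congrArg Cpx.im (hs U V)
    exact ⟨Cpx.mk a b, fun U => Cpx.ext (ha U) (hb U), fun t ht =>
      Cpx.ext (ua _ fun U => congrArg Cpx.re (ht U)) (ub _ fun U => congrArg Cpx.im (ht U))⟩

theorem Cpx.map₂_mk_zero {V W X : Type*} [AddCommGroup V] [Module ℝ V] [AddCommGroup W]
    [Module ℝ W] [AddCommGroup X] [Module ℝ X] (B : V →ₗ[ℝ] W →ₗ[ℝ] X) (z : Cpx V) (y : W) :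
    Cpx.map₂ B z (Cpx.mk y 0) = Cpx.mk (B z.re y) (B z.im y) := by
  ext <;> simp

theorem Cpx.map_mk_zero {V W : Type*} [AddCommGroup V] [Module ℝ V] [AddCommGroup W]
    [Module ℝ W] (F : V →ₗ[ℝ] W) (y : V) : Cpx.map F (Cpx.mk y 0) = Cpx.mk (F y) 0 := by
  ext <;> simp

theorem GModSheaf.IsLocalFrame.cpx {A : GAlgSheaf.{u, v} ℝ M} {E : GModSheaf.{u, v, w} A}
    {U : Opens M} {r : ℕ} {deg : Fin r → ℤ} {Φ : ∀ l, (E.sec U).obj (deg l)}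
    (hΦ : E.IsLocalFrame (fun _ _ => ⊤) U deg Φ) :
    E.cpx.IsLocalFrame (fun _ _ => ⊤) U deg (fun l => Cpx.mk (Φ l) 0) := by
  refine ⟨fun _ => trivial, fun V hV i ψ _ => ?_⟩
  have key : ∀ f : ∀ l, Cpx ((A.sec V).obj (i - deg l)),
      ∑ l, (E.cpx.sec V).smul (sub_add_cancel i (deg l)) (f l)
        (E.cpx.res hV (Cpx.mk (Φ l) 0)) =
      Cpx.mk (∑ l, (E.sec V).smul (sub_add_cancel i (deg l)) (f l).re (E.res hV (Φ l)))
        (∑ l, (E.sec V).smul (sub_add_cancel i (deg l)) (f l).im (E.res hV (Φ l))) := by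
    intro f
    have e : ∀ l, (E.cpx.sec V).smul (sub_add_cancel i (deg l)) (f l)
        (E.cpx.res hV (Cpx.mk (Φ l) 0)) =
        Cpx.mk ((E.sec V).smul (sub_add_cancel i (deg l)) (f l).re (E.res hV (Φ l)))
          ((E.sec V).smul (sub_add_cancel i (deg l)) (f l).im (E.res hV (Φ l))) := by
      intro l
      exact (congrArg _ (Cpx.map_mk_zero _ _)).trans (Cpx.map₂_mk_zero _ _ _)
    rw [Finset.sum_congr rfl fun l _ => e l]
    exact Cpx.ext (Cpx.re_sum _ _) (Cpx.im_sum _ _)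
  obtain ⟨a, ha, ua⟩ := hΦ.2 V hV i (Cpx.re ψ) trivial
  obtain ⟨b, hb, ub⟩ := hΦ.2 V hV i (Cpx.im ψ) trivial
  refine ⟨fun l => Cpx.mk (a l) (b l), (Cpx.ext ha hb).trans (key _).symm, fun f hf => ?_⟩
  have hf' := Eq.trans hf (key f)
  have h₁ := ua (fun l => Cpx.re (f l)) (congrArg Cpx.re hf')
  have h₂ := ub (fun l => Cpx.im (f l)) (congrArg Cpx.im hf')
  funext l
  exact Cpx.ext (congrFun h₁ l) (congrFun h₂ l)

/-- The complexification `E_ℂ` of a graded vector bundle. -/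
@[reducible]
def GradedVectorBundle.cpx {A : GAlgSheaf.{u, v} ℝ M} (E : GradedVectorBundle.{u, v, w} A) :
    GradedVectorBundle.{u, v, w} A.cpx where
  toGModSheaf := E.toGModSheaf.cpx
  rank := E.rank
  locally_free m := by
    obtain ⟨U, hm, r, deg, Φ, hr, hΦ⟩ := E.locally_free m
    exact ⟨U, hm, r, deg, fun l => Cpx.mk (Φ l) 0, hr, hΦ.cpx⟩

variable {A : GAlgSheaf.{u, v} ℝ M} {E : GradedVectorBundle.{u, v, w} A}

/-- The sections of the complex conjugate `L̄` of a complex subbundle `L` of `E_ℂ`. -/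
def Subbundle.conj (L : Subbundle E.cpx) (U : Opens M) (i : ℤ) :
    Submodule ℂ ((E.cpx.sec U).obj i) :=
  (L.sec U i).map Cpx.conj

/-- Generalized complex structures: complex subbundles `L` of `E_ℂ` which are isotropic for the complex
bilinear extension of the pairing, involutive for the complex bilinear extension of the bracket, and
satisfy `E_ℂ = L ⊕ L̄` on all open sets.  As for the bracket, isotropy is only required of global sections
(cutting off sections by bump functions gives it on all open sets). -/
structure CourantData.IsGeneralizedComplex {ℓ : ℤ} (C : CourantData E ℓ)
    (L : Subbundle E.cpx) : Prop where
  isotropic : ∀ {i j k : ℤ} (h : i + j + ℓ = k), ∀ φ ∈ L.sec ⊤ i, ∀ φ' ∈ L.sec ⊤ j,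
    Cpx.map₂ (C.pairing h) φ φ' = 0
  involutive : ∀ {i j k : ℤ} (h : i + j + ℓ = k), ∀ φ ∈ L.sec ⊤ i, ∀ φ' ∈ L.sec ⊤ j,
    Cpx.map₂ (C.bracket h) φ φ' ∈ L.sec ⊤ k
  isCompl_conj : ∀ (U : Opens M) (i : ℤ), IsCompl (L.sec U i) (L.conj U i)

end ComplexBundles

end

/-! Everything reduces to linear algebra on one real vector space V. Let K be a complex subspace of
V_ℂ with V_ℂ = K ⊕ K̄. Then taking real parts is a real-linear bijection K → V (`eq_of_re_eq`,
`exists_mem_re_eq`). Multiplication by i on K transports along it to an operator J on V, that is,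
J(re l) = re(i l) = -im l for l ∈ K. Hence J² = -1, and the ±i eigenspaces of J_ℂ are K and K̄.
Conversely, an operator whose complexification has +i eigenspace K must satisfy J(re l) = -im l,
which gives uniqueness (`eq_complexStructure`).

For K = Γ_L(U) in each degree, every remaining property is a property of L read through this
bijection. J is linear over functions because L is a submodule, and it commutes with restriction
because L does. The real part of ⟨l, l'⟩ = 0 is orthogonality. Since [l, l'] lies in L, J maps its
imaginary part to its real part, and this equation is N_J = 0. Because the splitting is given on
every open set, the restrictions of J are constructed directly, with no localization argument. -/

namespace Cpx

/-! ### Linear algebra: complex structures from splittings V_ℂ = K ⊕ K̄ -/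

variable {V : Type*} [AddCommGroup V] [Module ℝ V]

@[simp] theorem re_neg {V : Type*} [AddCommGroup V] (z : Cpx V) : (-z).re = -z.re := rfl
@[simp] theorem im_neg {V : Type*} [AddCommGroup V] (z : Cpx V) : (-z).im = -z.im := rfl
@[simp] theorem re_conj (z : Cpx V) : (conj z).re = z.re := rfl
@[simp] theorem im_conj (z : Cpx V) : (conj z).im = -z.im := rfl

/-- A complex subspace `K` with `K ⊕ K̄` the whole complexification contains at most one vector with a
given real part. -/
theorem eq_of_re_eq {K : Submodule ℂ (Cpx V)} (hK : IsCompl K (K.map conj)) {l l' : Cpx V}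
    (hl : l ∈ K) (hl' : l' ∈ K) (h : l.re = l'.re) : l = l' := by
  have hd : l - l' ∈ K := K.sub_mem hl hl'
  have hre : (l - l').re = 0 := sub_eq_zero.mpr h
  -- The difference d is purely imaginary, so conj d = -d; thus d = conj (-d) also lies in K̄, and K
  -- ∩ K̄ = 0.
  have hc : l - l' ∈ K.map conj :=
    ⟨-(l - l'), K.neg_mem hd, by
      ext
      · change -(l - l').re = (l - l').re
        rw [hre, neg_zero]
      · change -(-(l - l').im) = (l - l').im
        rw [neg_neg]⟩
  exact sub_eq_zero.mp (Submodule.disjoint_def.mp hK.disjoint _ hd hc)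

/-- If `K ⊕ K̄` is the whole complexification, every real vector is the real part of a vector of `K`. -/
theorem exists_mem_re_eq {K : Submodule ℂ (Cpx V)} (hK : IsCompl K (K.map conj)) (x : V) :
    ∃ l ∈ K, l.re = x := by
  obtain ⟨l, hl, _, ⟨m, hm, rfl⟩, h⟩ :=
    Submodule.mem_sup.mp (hK.sup_eq_top ▸ Submodule.mem_top : mk x 0 ∈ K ⊔ K.map conj)
  -- Here x = l + conj m with l, m ∈ K. Conjugation keeps real parts, so replacing conj m by m moves
  -- the sum into K without changing its real part.
  exact ⟨l + m, K.add_mem hl hm, congrArg re h⟩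

/-- The real and imaginary parts of J_ℂ z = i z. Both equations are needed, since J is not assumed
to square to -1. -/
theorem mem_eigenspace_I {J : V →ₗ[ℝ] V} {z : Cpx V} :
    z ∈ Module.End.eigenspace (map J) Complex.I ↔ J z.re = -z.im ∧ J z.im = z.re := by
  simp [Cpx.ext_iff]

theorem mem_eigenspace_neg_I {J : V →ₗ[ℝ] V} {z : Cpx V} :
    z ∈ Module.End.eigenspace (map J) (-Complex.I) ↔ J z.re = z.im ∧ J z.im = -z.re := by
  simp [Cpx.ext_iff]

/-- The operator `J` on `V` with `J (re l) = - im l` for `l ∈ K`, where `K ⊕ K̄` is the whole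
complexification. -/
noncomputable def complexStructure (K : Submodule ℂ (Cpx V)) (hK : IsCompl K (K.map conj)) : V →ₗ[ℝ] V :=
  -- Lifts to K are unique, so the chosen lift may be replaced by any other. Linearity then follows
  -- by lifting a sum to the sum of lifts and c • x to (c : ℂ) • l.
  have key : ∀ l ∈ K, ∀ x, l.re = x → -(exists_mem_re_eq hK x).choose.im = -l.im := by
    intro l hl x hx
    have hc := (exists_mem_re_eq hK x).choose_spec
    rw [eq_of_re_eq hK hc.1 hl (hc.2.trans hx.symm)]
  { toFun := fun x => -(exists_mem_re_eq hK x).choose.im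
    map_add' := by
      intro x y
      obtain ⟨l, hl, hx⟩ := exists_mem_re_eq hK x
      obtain ⟨m, hm, hy⟩ := exists_mem_re_eq hK y
      rw [key l hl x hx, key m hm y hy, key (l + m) (K.add_mem hl hm) (x + y) (by simp [hx, hy]),
        im_add, neg_add]
    map_smul' := by
      intro c x
      obtain ⟨l, hl, hx⟩ := exists_mem_re_eq hK x
      rw [key l hl x hx, key ((c : ℂ) • l) (K.smul_mem _ hl) (c • x) (by rw [re_smul]; simp [hx]),
        im_smul]
      simp }

variable {K : Submodule ℂ (Cpx V)} (hK : IsCompl K (K.map conj))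

/-- Removes the choice from the definition: any lift in K computes the operator. -/
theorem complexStructure_re {l : Cpx V} (hl : l ∈ K) : complexStructure K hK l.re = -l.im := by
  have hc := (exists_mem_re_eq hK l.re).choose_spec
  change -(exists_mem_re_eq hK l.re).choose.im = -l.im
  rw [eq_of_re_eq hK hc.1 hl hc.2]

/-- The vector -i l also lies in K, with real part im l and imaginary part -re l. -/
theorem complexStructure_im {l : Cpx V} (hl : l ∈ K) : complexStructure K hK l.im = l.re := by
  have h := complexStructure_re hK (K.smul_mem (-Complex.I) hl)
  simpa using h

theorem complexStructure_complexStructure (x : V) :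
    complexStructure K hK (complexStructure K hK x) = -x := by
  obtain ⟨l, hl, rfl⟩ := exists_mem_re_eq hK x
  rw [complexStructure_re hK hl, map_neg, complexStructure_im hK hl]

theorem eigenspace_complexStructure_I :
    Module.End.eigenspace (map (complexStructure K hK)) Complex.I = K := by
  ext z
  rw [mem_eigenspace_I]
  refine ⟨fun h => ?_, fun h => ⟨complexStructure_re hK h, complexStructure_im hK h⟩⟩
  -- Compare z with the lift l of its real part: the eigenvalue equation and the defining property
  -- of J both give -J(re z) as the imaginary part, so z = l.
  obtain ⟨l, hl, hz⟩ := exists_mem_re_eq hK z.re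
  have him : z.im = l.im := by
    rw [← neg_inj, ← h.1, ← hz, complexStructure_re hK hl]
  rwa [Cpx.ext hz.symm him]

/-- J_ℂ comes from a real operator, so conjugation commutes with it and exchanges the two
eigenspaces. -/
theorem eigenspace_complexStructure_neg_I :
    Module.End.eigenspace (map (complexStructure K hK)) (-Complex.I) = K.map conj := by
  ext z
  -- Conjugation is an involution, so the image of K is also its preimage.
  have hz : z ∈ K.map conj ↔ conj z ∈ K := by
    constructor
    · rintro ⟨w, hw, rfl⟩
      rwa [show conj (conj w) = w by ext <;> simp]
    · exact fun h => ⟨conj z, h, by ext <;> simp⟩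
  rw [hz, mem_eigenspace_neg_I]
  conv_rhs => rw [← eigenspace_complexStructure_I hK, mem_eigenspace_I]
  simp [neg_eq_iff_eq_neg]

/-- The complex structure is determined by its `+i` eigenspace. -/
theorem eq_complexStructure {J : V →ₗ[ℝ] V}
    (h : Module.End.eigenspace (map J) Complex.I = K) : J = complexStructure K hK := by
  ext x
  obtain ⟨l, hl, rfl⟩ := exists_mem_re_eq hK x
  rw [complexStructure_re hK hl]
  exact (mem_eigenspace_I.mp (h ▸ hl)).1

end Cpx

/-! ### The sheaf morphism attached to a subbundle L with E_ℂ = L ⊕ L̄ -/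

namespace Subbundle

variable {M : Type u} [TopologicalSpace M] {A : GAlgSheaf.{u, v} ℝ M}
  {E : GradedVectorBundle.{u, v, w} A} (L : Subbundle E.cpx)
  (hL : ∀ (U : Opens M) (i : ℤ), IsCompl (L.sec U i) (L.conj U i))

/-- The complex structure on the sections of `E` over `U` whose `+i` eigenspace is `L`. -/
noncomputable def complexStructure (U : Opens M) : (E.sec U).Hom (E.sec U) 0 :=
  ⟨⟨fun {i k} h =>
    -- Since i + 0 = k only propositionally, the degree is transported; for k = i the transport
    -- reduces away, and the defining equations below hold definitionally.
    (show i = k by omega) ▸ Cpx.complexStructure (L.sec U i) (hL U i)⟩, by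
    intro i j k m n h₁ h₂ h₃ h₄ f x
    obtain rfl : k = n := by omega
    obtain rfl : j = m := by omega
    obtain ⟨l, hl, rfl⟩ := Cpx.exists_mem_re_eq (hL U j) x
    -- A real function f multiplies real and imaginary parts separately, so f l is the lift of f ·
    -- re l in L. The sign (-1)^(|f| · 0) is trivial.
    have hfl := L.smul_mem h₁ (Cpx.mk f 0) hl
    have h := Cpx.complexStructure_re (hL U k) hfl
    simp only [Cpx.re_map₂, Cpx.im_map₂, Cpx.re_mk, Cpx.im_mk, map_zero, LinearMap.zero_apply,
      sub_zero, add_zero] at h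
    change Cpx.complexStructure _ (hL U k) _ =
      (i * 0).negOnePow • (E.sec U).smul h₄ f (Cpx.complexStructure _ (hL U j) l.re)
    rw [h, Cpx.complexStructure_re (hL U j) hl, mul_zero, Int.negOnePow_zero, one_smul, map_neg]⟩

theorem complexStructure_re {U : Opens M} {i : ℤ} {l : Cpx ((E.sec U).obj i)}
    (hl : l ∈ L.sec U i) : (L.complexStructure hL U).1.app (add_zero i) l.re = -l.im :=
  Cpx.complexStructure_re (hL U i) hl

theorem complexStructure_im {U : Opens M} {i : ℤ} {l : Cpx ((E.sec U).obj i)}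
    (hl : l ∈ L.sec U i) : (L.complexStructure hL U).1.app (add_zero i) l.im = l.re :=
  Cpx.complexStructure_im (hL U i) hl

/-- The complex structures on sections over open sets form a morphism of sheaves. -/
noncomputable def complexStructureRestrictions : VBMap.Restrictions (L.complexStructure hL ⊤) where
  on := L.complexStructure hL
  res_on := by
    intro U V hV i k h x
    obtain rfl : i = k := by omega
    -- Restriction preserves L and acts on real and imaginary parts separately, so the restriction
    -- of a lift is a lift of the restriction.
    obtain ⟨l, hl, rfl⟩ := Cpx.exists_mem_re_eq (hL U i) x
    change E.res hV (Cpx.complexStructure _ (hL U i) l.re) =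
      Cpx.complexStructure _ (hL V i) (E.res hV l.re)
    rw [Cpx.complexStructure_re (hL U i) hl, map_neg]
    exact (Cpx.complexStructure_re (hL V i) (L.res_mem hV hl)).symm
  on_top := rfl

end Subbundle

/-! ### Orthogonality, integrability and the main theorem -/

theorem CourantData.IsGeneralizedComplex.isOrthogonal {M : Type u} [TopologicalSpace M]
    {A : GAlgSheaf.{u, v} ℝ M} {E : GradedVectorBundle.{u, v, w} A} {ℓ : ℤ} {C : CourantData E ℓ}
    {L : Subbundle E.cpx} (hL : C.IsGeneralizedComplex L) :
    C.IsOrthogonal (L.complexStructure hL.isCompl_conj ⊤) := by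
  intro i j k h ψ ψ'
  obtain ⟨l, hl, rfl⟩ := Cpx.exists_mem_re_eq (hL.isCompl_conj ⊤ i) ψ
  obtain ⟨l', hl', rfl⟩ := Cpx.exists_mem_re_eq (hL.isCompl_conj ⊤ j) ψ'
  -- The real part of isotropy reads ⟨re l, re l'⟩ = ⟨im l, im l'⟩, and im l = -J(re l); the two
  -- minus signs cancel.
  have h₀ := congrArg Cpx.re (hL.isotropic h l hl l' hl')
  rw [Cpx.re_map₂, Cpx.re_zero, sub_eq_zero] at h₀
  rw [L.complexStructure_re _ hl, L.complexStructure_re _ hl', h₀]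
  simp

theorem CourantData.IsGeneralizedComplex.nijenhuis_eq_zero {M : Type u} [TopologicalSpace M]
    {A : GAlgSheaf.{u, v} ℝ M} {E : GradedVectorBundle.{u, v, w} A} {ℓ : ℤ} {C : CourantData E ℓ}
    {L : Subbundle E.cpx} (hL : C.IsGeneralizedComplex L) {i j k : ℤ} (h : i + j + ℓ = k)
    (ψ : (E.sec ⊤).obj i) (ψ' : (E.sec ⊤).obj j) :
    C.nijenhuis (L.complexStructure hL.isCompl_conj ⊤) h ψ ψ' = 0 := by
  unfold CourantData.nijenhuis
  obtain ⟨l, hl, rfl⟩ := Cpx.exists_mem_re_eq (hL.isCompl_conj ⊤ i) ψ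
  obtain ⟨l', hl', rfl⟩ := Cpx.exists_mem_re_eq (hL.isCompl_conj ⊤ j) ψ'
  -- With ψ = re l and ψ' = re l', the bracket [l, l'] has real part [ψ, ψ'] - [Jψ, Jψ'] and
  -- imaginary part -([ψ, Jψ'] + [Jψ, ψ']). As it lies in L, J sends the latter to the former.
  have h₀ := L.complexStructure_im hL.isCompl_conj (hL.involutive h l hl l' hl')
  rw [Cpx.re_map₂, Cpx.im_map₂] at h₀
  rw [L.complexStructure_re _ hl, L.complexStructure_re _ hl']
  simp only [map_neg, LinearMap.neg_apply, neg_neg]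
  rw [← neg_add, map_neg, h₀]
  abel

theorem mainTheorem8 {M : Type u} [TopologicalSpace M] [T2Space M] [SecondCountableTopology M]
    (𝓜 : GradedManifold.{u, v} M) (E : GradedVectorBundle.{u, v, w} 𝓜.sheaf) (ℓ : ℤ)
    (C : GradedCourantAlgebroid E ℓ) (L : Subbundle E.cpx) (hL : C.IsGeneralizedComplex L) :
    ∃! J : VBMap E E 0,
      ((∀ (i : ℤ) (ψ : (E.sec ⊤).obj i),
          J.1.app (add_zero i) (J.1.app (add_zero i) ψ) = -ψ) ∧
        C.IsOrthogonal J) ∧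
      (∀ {i j k : ℤ} (h : i + j + ℓ = k) (ψ : (E.sec ⊤).obj i) (ψ' : (E.sec ⊤).obj j),
        C.nijenhuis J h ψ ψ' = 0) ∧
      ∃ JU : VBMap.Restrictions J, ∀ (U : Opens M) (i : ℤ),
        Module.End.eigenspace (Cpx.map ((JU.on U).1.app (add_zero i))) Complex.I = L.sec U i ∧
        Module.End.eigenspace (Cpx.map ((JU.on U).1.app (add_zero i))) (-Complex.I) =
          L.conj U i := by
  refine ⟨L.complexStructure hL.isCompl_conj ⊤, ⟨⟨fun i ψ => ?_, hL.isOrthogonal⟩,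
    hL.nijenhuis_eq_zero, L.complexStructureRestrictions hL.isCompl_conj, fun U i => ⟨?_, ?_⟩⟩, ?_⟩
  · exact Cpx.complexStructure_complexStructure (hL.isCompl_conj ⊤ i) ψ
  · exact Cpx.eigenspace_complexStructure_I (hL.isCompl_conj U i)
  · exact Cpx.eigenspace_complexStructure_neg_I (hL.isCompl_conj U i)
  · rintro J ⟨-, -, JU, hJU⟩
    refine Subtype.ext (GradedMap.ext' fun {i k} h x => ?_)
    obtain rfl : i = k := by omega
    -- A bundle map is given by its action on global sections, so the +i eigenspace over the whole
    -- of M already determines it.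
    have hJ := (hJU ⊤ i).1
    rw [JU.on_top] at hJ
    exact LinearMap.congr_fun (Cpx.eq_complexStructure (hL.isCompl_conj ⊤ i) hJ) x
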